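/- Let $E$ be a field, let $\tilde K=\bigcup_{n\ge 1}E((t^{-1/n}))$ be the Puiseux field with the valuation $\nu$ normalised by $\nu(t^{r})=-r$ for $r\in\mathbb{Q}$ and trivial on $E^{*}$ (so $\nu(\sum_i a_i t^{-q_i})$ is the least $q_i$ with $a_i\neq 0$), let $\hat K$ be its completion, and let $\bar A\subset\tilde K$ be the ring of Puiseux polynomials, i.e. of finite sums $\sum_i a_i t^{r_i}$ with $a_i\in E$ and $r_i\in\mathbb{Q}_{\ge 0}$. Let $\mathbb{H}=\mathbb{H}^{\mathrm{Berk}}_{\mathbb{R}}$ be the set of points of type II and III of the Berkovich projective line over $\hat K$, that is, $\mathbb{H}=(\hat K\times\mathbb{R})/\!\sim$, where $(a,r)\sim(a',r')$ if and only if $r=r'$ and $\nu(a-a')\ge r$. The class of $(a,r)$ is written $\eta_{a,r}$; it corresponds to the closed ball $\{b\in\hat K:\nu(b-a)\ge r\}$. The distance on $\mathbb{H}$ is $d(\eta_{a,r},\eta_{a',r'})=|r-r'|$ if $\nu(a-a')\ge\min(r,r')$, and $r+r'-2\nu(a-a')$ otherwise. The point $\eta_{a',r'}$ lies below $\eta_{a,r}$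 if $r\le r'$ and $r\le\nu(a-a')$. For $\eta\in\mathbb{H}$ and $s\in\mathbb{R}$ let $\mathcal{V}^{s}_{\downarrow}(\eta)$ be the set of points of $\mathbb{H}$ that lie below $\eta$ at distance $s$ from it. The group $\mathrm{GL}_2(\hat K)$ acts on $\mathbb{H}$ by Möbius transformations: for $g=\begin{pmatrix}\alpha&\beta\\ \gamma&\delta\end{pmatrix}$, $$g*\eta_{a,r}=\begin{cases}\eta_{\frac{\alpha a+\beta}{\gamma a+\delta},\;r+\nu(\det g)-2\nu(\gamma a+\delta)},&\text{if }\nu(\gamma a+\delta)<\nu(\gamma)+r,\\[2pt] \eta_{\frac{\alpha}{\gamma},\;\nu(\det g)-2\nu(\gamma)-r},&\text{otherwise,}\end{cases}$$ and $\mathrm{SL}_2(\bar A)$ acts as a subgroup of $\mathrm{GL}_2(\hat K)$. Then: (a) For all real $r\le 0$ and $0<s\le -r$, the stabilizer of $\eta_{0,r}$ in $\mathrm{SL}_2(\bar A)$ preserves $\mathcal{V}^{s}_{\downarrow}(\eta_{0,r})$ and acts transitively on it. (b) The modular ray $\mathscr{R}_\infty=\{\eta_{0,r}: r\in\mathbb{R},\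 r\le 0\}$ is a fundamental domain for the action of $\mathrm{SL}_2(\bar A)$ on $\mathbb{H}$: every $\mathrm{SL}_2(\bar A)$-orbit in $\mathbb{H}$ meets $\mathscr{R}_\infty$ in exactly one point. -/

import Mathlib

noncomputable section

namespace PuiseuxBerk

open Matrix

/-! ### The Puiseux field, its completion, and Puiseux polynomials

Hahn series over `E` with exponents in `ℚ` are used as an ambient field; the Hahn series
`∑ a_q X ^ q` stands for `∑ a_q t ^ (-q)`, so that its order is the valuation `ν`. -/

section Field

variable (E : Type*) [Field E]

/-- The homomorphism `E((X)) → E⟦ℚ⟧` sending `X` to `X ^ (1 / n)`, that is, to `t ^ (-1 / n)`. -/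
def laurentEmb (n : ℕ+) : LaurentSeries E →+* HahnSeries ℚ E :=
  HahnSeries.embDomainRingHom
    ((AddMonoidHom.mulRight ((n : ℚ)⁻¹)).comp (Int.castAddHom ℚ))
    (by
      intro a b h
      have hn : ((n : ℕ) : ℚ)⁻¹ ≠ 0 := by simp
      simpa [hn] using h)
    (by
      intro a b
      have hn : (0 : ℚ) < ((n : ℕ) : ℚ)⁻¹ := by simp
      simp [mul_le_mul_iff_left₀ hn])

/-- The field `K_n = E((t ^ (-1 / n)))`. -/
def kField (n : ℕ+) : Subfield (HahnSeries ℚ E) := (laurentEmb E n).fieldRange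

theorem mem_kField_iff (n : ℕ+) (x : HahnSeries ℚ E) :
    x ∈ kField E n ↔ ∀ q ∈ x.support, ∃ k : ℤ, (k : ℚ) / n = q := by
  constructor
  · rintro ⟨y, rfl⟩ q hq
    by_contra! h
    refine hq (HahnSeries.embDomain_of_notMem_range ?_)
    rintro ⟨k, hk⟩
    exact h k (by rw [← hk]; simp [div_eq_mul_inv])
  · intro h
    have hinj : Function.Injective (fun k : ℤ => (k : ℚ) * ((n : ℕ) : ℚ)⁻¹) := by
      intro a b hab
      have hn : ((n : ℕ) : ℚ)⁻¹ ≠ 0 := by simp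
      simpa [hn] using hab
    have hmono : Monotone (fun k : ℤ => (k : ℚ) * ((n : ℕ) : ℚ)⁻¹) := by
      intro a b hab
      have hn : (0 : ℚ) < ((n : ℕ) : ℚ)⁻¹ := by simp
      exact mul_le_mul_of_nonneg_right (by exact_mod_cast hab) hn.le
    have hstrict := hmono.strictMono_of_injective hinj
    let y : LaurentSeries E :=
      { coeff := fun k => x.coeff ((k : ℚ) * ((n : ℕ) : ℚ)⁻¹)
        isPWO_support' := by
          have hx := x.isWF_support
          rw [Set.isPWO_iff_isWF]
          rw [Set.isWF_iff_no_descending_seq] at hx ⊢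
          intro f hf hmem
          exact hx (fun i => (f i : ℚ) * ((n : ℕ) : ℚ)⁻¹) (fun i j hij => hstrict (hf hij))
            (fun i => hmem i) }
    refine ⟨y, ?_⟩
    ext q
    by_cases hq : ∃ k : ℤ, (k : ℚ) * ((n : ℕ) : ℚ)⁻¹ = q
    · obtain ⟨k, rfl⟩ := hq
      exact HahnSeries.embDomain_coeff (x := y) (a := k)
    · have h1 : x.coeff q = 0 := by
        by_contra hne
        obtain ⟨k, hk⟩ := h q hne
        exact hq ⟨k, by rw [← hk, div_eq_mul_inv]⟩
      rw [h1]
      refine HahnSeries.embDomain_of_notMem_range ?_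
      rintro ⟨k, hk⟩
      exact hq ⟨k, hk⟩

/-- The Puiseux field `⋃ n, K_n`, as a subfield of the field of Hahn series. -/
def puiseuxSubfield : Subfield (HahnSeries ℚ E) := ⨆ n : ℕ+, kField E n

theorem mem_puiseuxSubfield (x : HahnSeries ℚ E) :
    x ∈ puiseuxSubfield E ↔ ∃ n : ℕ+, x ∈ kField E n := by
  refine Subfield.mem_iSup_of_directed ?_
  intro m n
  refine ⟨m * n, ?_, ?_⟩ <;> intro x hx <;> rw [mem_kField_iff] at hx ⊢ <;> intro q hq <;>
    obtain ⟨k, rfl⟩ := hx q hq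
  · refine ⟨k * n, ?_⟩
    have : ((n : ℕ) : ℚ) ≠ 0 := by simp
    push_cast
    field_simp
  · refine ⟨k * m, ?_⟩
    have : ((m : ℕ) : ℚ) ≠ 0 := by simp
    push_cast
    field_simp

theorem mem_puiseuxSubfield_of_finite (x : HahnSeries ℚ E) (hx : x.support.Finite) :
    x ∈ puiseuxSubfield E := by
  have key : ∀ s : Finset ℚ, ∃ n : ℕ+, ∀ q ∈ s, ∃ k : ℤ, (k : ℚ) / n = q := by
    intro s
    induction s using Finset.induction_on with
    | empty => exact ⟨1, by simp⟩
    | insert a s _ ih =>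
      obtain ⟨n, hn⟩ := ih
      have h0 : ((n : ℕ) : ℚ) ≠ 0 := by simp
      have h1 : (a.den : ℚ) ≠ 0 := by simp
      refine ⟨n * a.pnatDen, fun q hq => ?_⟩
      rcases Finset.mem_insert.1 hq with rfl | hq
      · refine ⟨q.num * n, ?_⟩
        conv_rhs => rw [← Rat.num_div_den q]
        push_cast [Rat.coe_pnatDen]
        field_simp
      · obtain ⟨k, rfl⟩ := hn q hq
        refine ⟨k * a.den, ?_⟩
        push_cast [Rat.coe_pnatDen]
        field_simp
  obtain ⟨n, hn⟩ := key hx.toFinset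
  exact (mem_puiseuxSubfield E x).2 ⟨n, (mem_kField_iff E n x).2 (by simpa using hn)⟩

/-- The Puiseux field `K̃ = E⟪⟪t⁻¹⟫⟫`. -/
def PuiseuxField : Type _ := puiseuxSubfield E

instance : Field (PuiseuxField E) := inferInstanceAs (Field (puiseuxSubfield E))

/-- The inclusion of the Puiseux field into the field of Hahn series. -/
def PuiseuxField.toHahn : PuiseuxField E →+* HahnSeries ℚ E := (puiseuxSubfield E).subtype

/-- The valuation `ν` on the Puiseux field: `ν (∑ a_q t ^ (-q))` is the least `q` with
`a_q ≠ 0`, and `ν 0 = ⊤`. -/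
def puiseuxVal : AddValuation (PuiseuxField E) (WithTop ℚ) :=
  (HahnSeries.addVal ℚ E).comap (PuiseuxField.toHahn E)

/-- The uniform structure that the valuation `ν` defines on the Puiseux field. -/
instance : Valued (PuiseuxField E) (Multiplicative (WithTop ℚ)ᵒᵈ) :=
  Valued.mk' (AddValuation.toValuation (puiseuxVal E))

/-- The completion `K̂` of the Puiseux field with respect to `ν`. -/
abbrev KHat : Type _ := UniformSpace.Completion (PuiseuxField E)

/-- The valuation `ν` on `K̂`, extended by continuity from the Puiseux field, with its values
(in `ℚ ∪ {∞}`) read in `ℝ ∪ {∞}`. -/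
def nu : AddValuation (KHat E) (WithTop ℝ) :=
  (AddValuation.ofValuation
      (Valued.extensionValuation (K := PuiseuxField E))).map
    (AddMonoidHom.withTopMap (Rat.castHom ℝ).toAddMonoidHom) rfl
    (by
      intro a b h
      change WithTop.map _ a ≤ WithTop.map _ b
      exact (WithTop.monotone_map_iff.2 (fun x y hxy => by
        simpa using hxy)) h)

theorem nu_coe (x : PuiseuxField E) :
    nu E (x : KHat E) = (puiseuxVal E x).map (fun q : ℚ => (q : ℝ)) := by
  exact congrArg (fun y : Multiplicative (WithTop ℚ)ᵒᵈ =>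
    WithTop.map (fun q : ℚ => (q : ℝ)) (OrderDual.ofDual y.toAdd))
    (Valued.extensionValuation_apply_coe x)

/-- The ring `Ā = E⟨t⟩` of Puiseux polynomials: finite sums `∑ a_i t ^ r_i` with `a_i ∈ E` and
`r_i ∈ ℚ`, `r_i ≥ 0`, that is, finitely supported series all of whose exponents `q = -r_i` in
`t⁻¹` are nonpositive. -/
def puiseuxPoly : Subring (PuiseuxField E) where
  carrier := {f | (f.toHahn E).support.Finite ∧ ∀ q ∈ (f.toHahn E).support, q ≤ 0}
  zero_mem' := by simp
  one_mem' := by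
    have h : ((1 : PuiseuxField E).toHahn E).support ⊆ {0} := by
      rw [map_one]; exact HahnSeries.support_single_subset
    exact ⟨(Set.finite_singleton _).subset h, fun q hq => (h hq).le⟩
  neg_mem' := by
    rintro f ⟨h1, h2⟩
    simpa [map_neg] using ⟨h1, h2⟩
  add_mem' := by
    rintro f g ⟨h1, h2⟩ ⟨h3, h4⟩
    have h : ((f + g).toHahn E).support ⊆ (f.toHahn E).support ∪ (g.toHahn E).support := by
      rw [map_add]; exact HahnSeries.support_add_subset _ _
    exact ⟨(h1.union h3).subset h, fun q hq => (h hq).elim (h2 q) (h4 q)⟩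
  mul_mem' := by
    rintro f g ⟨h1, h2⟩ ⟨h3, h4⟩
    have h : ((f * g).toHahn E).support ⊆
        Set.image2 (· + ·) (f.toHahn E).support (g.toHahn E).support := by
      rw [map_mul]
      exact HahnSeries.support_mul_subset
    refine ⟨(h1.image2 _ h3).subset h, fun q hq => ?_⟩
    obtain ⟨a, ha, b, hb, rfl⟩ := h hq
    exact add_nonpos (h2 a ha) (h4 b hb)

/-- The inclusion `Ā → K̂`. -/
def polyToKHat : puiseuxPoly E →+* KHat E :=
  (UniformSpace.Completion.coeRingHom (α := PuiseuxField E)).comp (puiseuxPoly E).subtype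

end Field

/-! ### The points of type II and III of the Berkovich line -/

section Points

variable {F : Type*} [Field F] (v : AddValuation F (WithTop ℝ))

/-- The real number `v x`, for `x ≠ 0`. -/
def ordR (x : F) : ℝ := (v x).untopD 0

variable {v} in
theorem val_eq {x : F} (hx : x ≠ 0) : v x = (ordR v x : WithTop ℝ) := by
  have h : v x ≠ ⊤ := fun h => hx ((AddValuation.top_iff v).1 h)
  obtain ⟨y, hy⟩ := WithTop.ne_top_iff_exists.1 h
  rw [ordR, ← hy, WithTop.untopD_coe]

variable {v} in
theorem ordR_of_val {x : F} {y : ℝ} (h : v x = (y : WithTop ℝ)) : ordR v x = y := by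
  rw [ordR, h, WithTop.untopD_coe]

variable {v} in
theorem ordR_mul {x y : F} (hx : x ≠ 0) (hy : y ≠ 0) :
    ordR v (x * y) = ordR v x + ordR v y := by
  refine ordR_of_val ?_
  rw [AddValuation.map_mul, val_eq hx, val_eq hy]
  rfl

variable {v} in
theorem ordR_div {x y : F} (hx : x ≠ 0) (hy : y ≠ 0) :
    ordR v (x / y) = ordR v x - ordR v y := by
  have h := ordR_mul (v := v) (div_ne_zero hx hy) hy
  rw [div_mul_cancel₀ x hy] at h
  linarith

variable {v} in
theorem ordR_neg (x : F) : ordR v (-x) = ordR v x := by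
  rw [ordR, AddValuation.map_neg, ordR]

variable {v} in
theorem ne_zero_of_val_lt {x : F} {c : WithTop ℝ} (h : v x < c) : x ≠ 0 := by
  rintro rfl
  rw [AddValuation.map_zero] at h
  exact not_top_lt h

variable {v} in
/-- `r ≤ v x` in terms of real numbers. -/
theorem le_val_iff {x : F} {r : ℝ} : (r : WithTop ℝ) ≤ v x ↔ (x ≠ 0 → r ≤ ordR v x) := by
  by_cases hx : x = 0
  · simp [hx]
  · rw [val_eq hx]; simp [hx]

variable {v} in
/-- `v x < v y + r` in terms of real numbers. -/
theorem val_lt_iff {x y : F} {r : ℝ} :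
    v x < v y + (r : WithTop ℝ) ↔ x ≠ 0 ∧ (y ≠ 0 → ordR v x < ordR v y + r) := by
  by_cases hx : x = 0
  · simp [hx]
  · rw [val_eq hx]
    by_cases hy : y = 0
    · simp [hx, hy]
    · rw [val_eq hy, ← WithTop.coe_add, WithTop.coe_lt_coe]
      simp [hx, hy]

variable {v} in
/-- The ultrametric inequality in terms of real numbers. -/
theorem le_ordR_add {x y : F} {r : ℝ} (hx : x ≠ 0 → r ≤ ordR v x) (hy : y ≠ 0 → r ≤ ordR v y)
    (hxy : x + y ≠ 0) : r ≤ ordR v (x + y) :=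
  le_val_iff.1 (AddValuation.map_le_add v (le_val_iff.2 hx) (le_val_iff.2 hy)) hxy

variable {v} in
/-- The dominance principle in terms of real numbers. -/
theorem ordR_add_eq {x y : F} (hx : x ≠ 0) (hy : y ≠ 0 → ordR v x < ordR v y) :
    x + y ≠ 0 ∧ ordR v (x + y) = ordR v x := by
  have h : v x < v y := by
    have := (val_lt_iff (v := v) (x := x) (y := y) (r := 0)).2 ⟨hx, by simpa using hy⟩
    simpa using this
  have h2 := AddValuation.map_add_eq_of_lt_left v h
  refine ⟨?_, by rw [ordR, h2, ordR]⟩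
  intro h0
  rw [h0, AddValuation.map_zero, val_eq hx] at h2
  exact WithTop.top_ne_coe h2

/-- `(a, r) ∼ (a', r)` if and only if `v (a - a') ≥ r`. -/
def ballSetoid : Setoid (F × ℝ) where
  r p q := p.2 = q.2 ∧ (p.2 : WithTop ℝ) ≤ v (p.1 - q.1)
  iseqv :=
    { refl := fun p => by simp
      symm := fun {p q} h => ⟨h.1.symm, by rw [AddValuation.map_sub_swap, ← h.1]; exact h.2⟩
      trans := fun {p q s} h h' => ⟨h.1.trans h'.1, by
        have h2 := h'.2
        rw [← h.1] at h2
        have := AddValuation.map_le_add v h.2 h2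
        rwa [sub_add_sub_cancel] at this⟩ }

/-- The set `ℍ_ℝ^Berk = (F × ℝ) / ∼` of points of type II and III of the Berkovich line over
the valued field `F`. -/
def BerkH : Type _ := Quotient (ballSetoid v)

namespace BerkH

/-- The point `η_{a,r}`, corresponding to the closed ball `{b | v (b - a) ≥ r}`. -/
def eta (a : F) (r : ℝ) : BerkH v := Quotient.mk (ballSetoid v) (a, r)

variable {v} in
theorem eta_eq_iff {a a' : F} {r r' : ℝ} :
    eta v a r = eta v a' r' ↔ r = r' ∧ (r : WithTop ℝ) ≤ v (a - a') :=
  ⟨fun h => Quotient.exact h, fun h => Quotient.sound h⟩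

variable {v} in
theorem exists_eta (x : BerkH v) : ∃ a r, x = eta v a r := by
  induction x using Quotient.inductionOn with
  | _ p => exact ⟨p.1, p.2, rfl⟩

/-- `above x y` says that `x` lies above `y`, i.e. that `y` lies below `x`:
`η_{a,r}` lies above `η_{a',r'}` if `r` exceeds neither `r'` nor `v (a - a')`. -/
def above (x y : BerkH v) : Prop :=
  Quotient.liftOn₂ x y (fun p q => p.2 ≤ q.2 ∧ (p.2 : WithTop ℝ) ≤ v (p.1 - q.1)) (by
    have key : ∀ p q p' q' : F × ℝ, (ballSetoid v).r p p' → (ballSetoid v).r q q' →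
        (p.2 ≤ q.2 ∧ (p.2 : WithTop ℝ) ≤ v (p.1 - q.1)) →
        (p'.2 ≤ q'.2 ∧ (p'.2 : WithTop ℝ) ≤ v (p'.1 - q'.1)) := by
      rintro ⟨a, r⟩ ⟨b, s⟩ ⟨a', r'⟩ ⟨b', s'⟩ ⟨h1, h2⟩ ⟨h3, h4⟩ ⟨h5, h6⟩
      simp only at h1 h2 h3 h4 h5 h6 ⊢
      subst h1 h3
      refine ⟨h5, ?_⟩
      have h7 : (r : WithTop ℝ) ≤ v (b - b') := le_trans (WithTop.coe_le_coe.2 h5) h4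
      rw [AddValuation.map_sub_swap] at h2
      have h8 := AddValuation.map_le_add v (AddValuation.map_le_add v h2 h6) h7
      rwa [sub_add_sub_cancel, sub_add_sub_cancel] at h8
    intro p q p' q' h h'
    exact propext ⟨key p q p' q' h h',
      key p' q' p q ((ballSetoid v).symm' h) ((ballSetoid v).symm' h')⟩)

variable {v} in
theorem above_eta {a a' : F} {r r' : ℝ} :
    above v (eta v a r) (eta v a' r') ↔ r ≤ r' ∧ (r : WithTop ℝ) ≤ v (a - a') := Iff.rfl

open Classical in
/-- The distance on `ℍ_ℝ^Berk`: `d (η_{a,r}, η_{a',r'})` is `|r - r'|` if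
`v (a - a') ≥ min r r'`, and `r + r' - 2 v (a - a')` otherwise. -/
def distance (x y : BerkH v) : ℝ :=
  Quotient.liftOn₂ x y
    (fun p q => if ((min p.2 q.2 : ℝ) : WithTop ℝ) ≤ v (p.1 - q.1) then |p.2 - q.2|
      else p.2 + q.2 - 2 * ordR v (p.1 - q.1)) (by
    rintro ⟨a, r⟩ ⟨b, s⟩ ⟨a', r'⟩ ⟨b', s'⟩ ⟨h1, h2⟩ ⟨h3, h4⟩
    simp only at h1 h2 h3 h4 ⊢
    subst h1 h3
    have e1 : ((min r s : ℝ) : WithTop ℝ) ≤ v (a - a') :=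
      le_trans (WithTop.coe_le_coe.2 (min_le_left _ _)) h2
    have e2 : ((min r s : ℝ) : WithTop ℝ) ≤ v (b' - b) := by
      rw [AddValuation.map_sub_swap]
      exact le_trans (WithTop.coe_le_coe.2 (min_le_right _ _)) h4
    have e3 := AddValuation.map_le_add v e1 e2
    by_cases h : ((min r s : ℝ) : WithTop ℝ) ≤ v (a - b)
    · have e4 : ((min r s : ℝ) : WithTop ℝ) ≤ v (a' - b') := by
        have := AddValuation.map_le_sub v h e3
        rwa [show a - b - (a - a' + (b' - b)) = a' - b' by ring] at this
      rw [if_pos h, if_pos e4]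
    · have e5 : v (a' - b') = v (a - b) := by
        have := AddValuation.map_sub_eq_of_lt_left v (lt_of_lt_of_le (not_le.1 h) e3)
        rwa [show a - b - (a - a' + (b' - b)) = a' - b' by ring] at this
      rw [e5, if_neg h, if_neg h, ordR, ordR, e5])

open Classical in
variable {v} in
theorem distance_eta {a a' : F} {r r' : ℝ} :
    distance v (eta v a r) (eta v a' r') =
      if ((min r r' : ℝ) : WithTop ℝ) ≤ v (a - a') then |r - r'|
      else r + r' - 2 * ordR v (a - a') := rfl

/-- The set of points below `x` and at distance `s` from it. -/
def below (s : ℝ) (x : BerkH v) : Set (BerkH v) := {y | above v x y ∧ distance v x y = s}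

open Classical in
/-- The Möbius action of a matrix `g = !![α, β; γ, δ]` on pairs `(a, r)`. If the pole of `g` is
outside the ball `{b | v (b - a) ≥ r}`, i.e. if `v (γ a + δ) < v γ + r`, then `g` maps this ball
onto the ball of centre `g a` and radius parameter `r + v (det g) - 2 v (γ a + δ)`. Otherwise
`g` maps the complement of the open ball `{b | v (b - a) > r}` about the pole onto the closed ball
of centre `g ∞ = α / γ` and radius parameter `v (det g) - 2 v γ - r`. -/
def moebius (g : Matrix (Fin 2) (Fin 2) F) (p : F × ℝ) : F × ℝ :=
  if v (g 1 0 * p.1 + g 1 1) < v (g 1 0) + (p.2 : WithTop ℝ) then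
    ((g 0 0 * p.1 + g 0 1) / (g 1 0 * p.1 + g 1 1),
      p.2 + ordR v g.det - 2 * ordR v (g 1 0 * p.1 + g 1 1))
  else (g 0 0 / g 1 0, ordR v g.det - 2 * ordR v (g 1 0) - p.2)

variable {v} in
theorem moebius_congr (g : Matrix (Fin 2) (Fin 2) F) (hg : g.det ≠ 0) (p q : F × ℝ)
    (h : (ballSetoid v).r p q) : (ballSetoid v).r (moebius v g p) (moebius v g q) := by
  obtain ⟨a, r⟩ := p
  obtain ⟨b, s⟩ := q
  obtain ⟨h1, h2⟩ := h
  simp only at h1 h2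
  subst h1
  have hdet := Matrix.det_fin_two g
  set α := g 0 0 with hα
  set β := g 0 1 with hβ
  set γ := g 1 0 with hγ
  set δ := g 1 1 with hδ
  have e1 : v γ + (r : WithTop ℝ) ≤ v (γ * (b - a)) := by
    rw [AddValuation.map_mul, AddValuation.map_sub_swap]
    gcongr
  have e2 : γ * a + δ + γ * (b - a) = γ * b + δ := by ring
  by_cases hc : v (γ * a + δ) < v γ + (r : WithTop ℝ)
  · have e3 : v (γ * b + δ) = v (γ * a + δ) := by
      rw [← e2]
      exact AddValuation.map_add_eq_of_lt_left v (lt_of_lt_of_le hc e1)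
    have ha := ne_zero_of_val_lt hc
    have hb : γ * b + δ ≠ 0 := by rw [← e3] at hc; exact ne_zero_of_val_lt hc
    have ho : ordR v (γ * b + δ) = ordR v (γ * a + δ) := by rw [ordR, e3, ordR]
    have hp : moebius v g (a, r) = ((α * a + β) / (γ * a + δ),
        r + ordR v g.det - 2 * ordR v (γ * a + δ)) := if_pos hc
    have hq : moebius v g (b, r) = ((α * b + β) / (γ * b + δ),
        r + ordR v g.det - 2 * ordR v (γ * b + δ)) := if_pos (by rw [← hγ, ← hδ, e3]; exact hc)
    rw [hp, hq]
    refine ⟨by rw [ho], ?_⟩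
    simp only
    rw [le_val_iff] at h2 ⊢
    have e4 : (α * a + β) / (γ * a + δ) - (α * b + β) / (γ * b + δ) =
        g.det * (a - b) / ((γ * a + δ) * (γ * b + δ)) := by
      rw [hdet, div_sub_div _ _ ha hb]
      congr 1
      ring
    rw [e4]
    intro hne
    have hab : a - b ≠ 0 := by
      rintro h0
      rw [h0] at hne
      simp at hne
    rw [ordR_div (mul_ne_zero hg hab) (mul_ne_zero ha hb), ordR_mul hg hab, ordR_mul ha hb, ho]
    linarith [h2 hab]
  · have hc' : ¬ v (γ * b + δ) < v γ + (r : WithTop ℝ) := by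
      rw [not_lt] at hc ⊢
      rw [← e2]
      exact AddValuation.map_le_add v hc e1
    have hp : moebius v g (a, r) = (α / γ, ordR v g.det - 2 * ordR v γ - r) := if_neg hc
    have hq : moebius v g (b, r) = (α / γ, ordR v g.det - 2 * ordR v γ - r) := if_neg hc'
    rw [hp, hq]

variable {v} in
theorem moebius_of_lt (g : Matrix (Fin 2) (Fin 2) F) {a : F} {r : ℝ}
    (hw : g 1 0 * a + g 1 1 ≠ 0)
    (hc : g 1 0 ≠ 0 → ordR v (g 1 0 * a + g 1 1) < ordR v (g 1 0) + r) :
    moebius v g (a, r) = ((g 0 0 * a + g 0 1) / (g 1 0 * a + g 1 1),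
      r + ordR v g.det - 2 * ordR v (g 1 0 * a + g 1 1)) :=
  if_pos (val_lt_iff.2 ⟨hw, hc⟩)

variable {v} in
theorem moebius_of_le (g : Matrix (Fin 2) (Fin 2) F) {a : F} {r : ℝ} (hγ : g 1 0 ≠ 0)
    (hc : g 1 0 * a + g 1 1 ≠ 0 → ordR v (g 1 0) + r ≤ ordR v (g 1 0 * a + g 1 1)) :
    moebius v g (a, r) = (g 0 0 / g 1 0, ordR v g.det - 2 * ordR v (g 1 0) - r) :=
  if_neg (fun h => by
    obtain ⟨h1, h2⟩ := val_lt_iff.1 h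
    linarith [h2 hγ, hc h1])

variable {v} in
theorem moebius_cases (g : Matrix (Fin 2) (Fin 2) F) (hg : g.det ≠ 0) (a : F) (r : ℝ) :
    (g 1 0 * a + g 1 1 ≠ 0 ∧
      (g 1 0 ≠ 0 → ordR v (g 1 0 * a + g 1 1) < ordR v (g 1 0) + r)) ∨
    (g 1 0 ≠ 0 ∧
      (g 1 0 * a + g 1 1 ≠ 0 → ordR v (g 1 0) + r ≤ ordR v (g 1 0 * a + g 1 1))) := by
  have hdet := Matrix.det_fin_two g
  by_cases h0 : g 1 0 = 0
  · left
    refine ⟨?_, fun h => absurd h0 h⟩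
    intro h1
    rw [h0, zero_mul, zero_add] at h1
    rw [h0, h1] at hdet
    exact hg (by simpa using hdet)
  · by_cases h1 : g 1 0 * a + g 1 1 = 0
    · exact Or.inr ⟨h0, fun h => absurd h1 h⟩
    · rcases lt_or_ge (ordR v (g 1 0 * a + g 1 1)) (ordR v (g 1 0) + r) with h | h
      · exact Or.inl ⟨h1, fun _ => h⟩
      · exact Or.inr ⟨h0, fun _ => h⟩

variable {v} in
theorem moebius_mul (h g : Matrix (Fin 2) (Fin 2) F) (hh : h.det ≠ 0) (hg : g.det ≠ 0)
    (p : F × ℝ) : (ballSetoid v).r (moebius v (h * g) p) (moebius v h (moebius v g p)) := by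
  obtain ⟨a, r⟩ := p
  have hD := Matrix.det_fin_two g
  have hD' := Matrix.det_fin_two h
  have hhg : (h * g).det ≠ 0 := by rw [Matrix.det_mul]; exact mul_ne_zero hh hg
  have odet : ordR v (h * g).det = ordR v h.det + ordR v g.det := by
    rw [Matrix.det_mul, ordR_mul hh hg]
  have m00 : (h * g) 0 0 = h 0 0 * g 0 0 + h 0 1 * g 1 0 := by
    simp [Matrix.mul_apply, Fin.sum_univ_two]
  have m01 : (h * g) 0 1 = h 0 0 * g 0 1 + h 0 1 * g 1 1 := by
    simp [Matrix.mul_apply, Fin.sum_univ_two]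
  have m10 : (h * g) 1 0 = h 1 0 * g 0 0 + h 1 1 * g 1 0 := by
    simp [Matrix.mul_apply, Fin.sum_univ_two]
  have m11 : (h * g) 1 1 = h 1 0 * g 0 1 + h 1 1 * g 1 1 := by
    simp [Matrix.mul_apply, Fin.sum_univ_two]
  have hcase := moebius_cases (v := v) (h * g) hhg a r
  have fst := moebius_of_lt (v := v) (h * g) (a := a) (r := r)
  have snd := moebius_of_le (v := v) (h * g) (a := a) (r := r)
  rw [odet] at fst snd
  set M := moebius v (h * g) (a, r) with hM
  rw [m00, m01, m10, m11] at fst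
  rw [m00, m10, m11] at snd
  rw [m10, m11] at hcase
  clear_value M
  clear hM m00 m01 m10 m11
  -- abbreviations
  have hwc : ∃ w, w = g 1 0 * a + g 1 1 := ⟨_, rfl⟩
  obtain ⟨w, hw⟩ := hwc
  have hγc : ∃ c, c = h 1 0 * g 0 0 + h 1 1 * g 1 0 := ⟨_, rfl⟩
  obtain ⟨c, hc⟩ := hγc
  have huc : ∃ u, u = h 1 0 * (g 0 0 * a + g 0 1) + h 1 1 * w := ⟨_, rfl⟩
  obtain ⟨u, hu⟩ := huc
  have hu' : c * a + (h 1 0 * g 0 1 + h 1 1 * g 1 1) = u := by rw [hu, hc, hw]; ring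
  have hnum : (h 0 0 * g 0 0 + h 0 1 * g 1 0) * a + (h 0 0 * g 0 1 + h 0 1 * g 1 1) =
      h 0 0 * (g 0 0 * a + g 0 1) + h 0 1 * w := by rw [hw]; ring
  rw [← hc, hu', hnum] at fst
  rw [← hc, hu'] at snd hcase
  rcases moebius_cases (v := v) g hg a r with ⟨hw0, hA⟩ | ⟨hγ, hA⟩
  · rw [moebius_of_lt g hw0 hA]
    rw [← hw] at hw0 hA ⊢
    -- value of the lower row of `h` at the new centre
    have hp : h 1 0 * ((g 0 0 * a + g 0 1) / w) + h 1 1 = u / w := by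
      rw [hu]; field_simp
    have hcd : c * w = g 1 0 * u + h 1 0 * g.det := by
      rw [hc, hu, hD, hw]; ring
    rcases moebius_cases (v := v) h hh ((g 0 0 * a + g 0 1) / w)
      (r + ordR v g.det - 2 * ordR v w) with ⟨hp0, hB⟩ | ⟨hγ', hB⟩
    · rw [moebius_of_lt h hp0 hB]
      rw [hp] at hp0 hB ⊢
      have hu0 : u ≠ 0 := fun h0 => hp0 (by rw [h0, zero_div])
      have ou := ordR_div (v := v) hu0 hw0
      have hc1 : c ≠ 0 → ordR v u < ordR v c + r := by
        intro hc0
        by_contra hlt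
        -- then `ν (c w) ≤ ν (u w) - r`, smaller than both summands
        have h1 := ordR_mul (v := v) hc0 hw0
        have h2 : g 1 0 * u ≠ 0 → ordR v u + ordR v w - r < ordR v (g 1 0 * u) := by
          intro hne
          have hg0 := left_ne_zero_of_mul hne
          rw [ordR_mul hg0 hu0]
          linarith [hA hg0]
        have h3 : h 1 0 * g.det ≠ 0 → ordR v u + ordR v w - r < ordR v (h 1 0 * g.det) := by
          intro hne
          have hg0 := left_ne_zero_of_mul hne
          rw [ordR_mul hg0 hg]
          linarith [hB hg0]
        have hne : g 1 0 * u + h 1 0 * g.det ≠ 0 := by rw [← hcd]; exact mul_ne_zero hc0 hw0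
        have h4 : ordR v u + ordR v w - r < ordR v (g 1 0 * u + h 1 0 * g.det) := by
          have e1 : ((ordR v u + ordR v w - r : ℝ) : WithTop ℝ) < v (g 1 0 * u) := by
            by_cases hz : g 1 0 * u = 0
            · rw [hz, AddValuation.map_zero]; exact WithTop.coe_lt_top _
            · rw [val_eq hz]; exact WithTop.coe_lt_coe.2 (h2 hz)
          have e2 : ((ordR v u + ordR v w - r : ℝ) : WithTop ℝ) < v (h 1 0 * g.det) := by
            by_cases hz : h 1 0 * g.det = 0
            · rw [hz, AddValuation.map_zero]; exact WithTop.coe_lt_top _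
            · rw [val_eq hz]; exact WithTop.coe_lt_coe.2 (h3 hz)
          have e3 := AddValuation.map_lt_add v e1 e2
          rw [val_eq hne] at e3
          exact WithTop.coe_lt_coe.1 e3
        rw [← hcd, h1] at h4
        linarith
      rw [fst hu0 hc1, ou]
      refine ⟨by simp only; ring, ?_⟩
      have : (h 0 0 * (g 0 0 * a + g 0 1) + h 0 1 * w) / u -
          (h 0 0 * ((g 0 0 * a + g 0 1) / w) + h 0 1) / (u / w) = 0 := by
        field_simp
        ring
      simp only [this, AddValuation.map_zero, le_top]
    · rw [moebius_of_le h hγ' hB]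
      rw [hp] at hB
      have hX : h 1 0 * g.det ≠ 0 := mul_ne_zero hγ' hg
      have oX := ordR_mul (v := v) hγ' hg
      have hdom := ordR_add_eq (v := v) (x := h 1 0 * g.det) (y := g 1 0 * u) hX (by
        intro hne
        have hg0 := left_ne_zero_of_mul hne
        have hu0 := right_ne_zero_of_mul hne
        have h1 := hB (div_ne_zero hu0 hw0)
        rw [ordR_div hu0 hw0] at h1
        rw [ordR_mul hg0 hu0, oX]
        linarith [hA hg0])
      rw [add_comm, ← hcd] at hdom
      obtain ⟨hcw, ocw⟩ := hdom
      have hc0 := left_ne_zero_of_mul hcw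
      rw [ordR_mul hc0 hw0, oX] at ocw
      have hc2 : u ≠ 0 → ordR v c + r ≤ ordR v u := by
        intro hu0
        have h1 := hB (div_ne_zero hu0 hw0)
        rw [ordR_div hu0 hw0] at h1
        linarith
      rw [snd hc0 hc2]
      refine ⟨by simp only; linarith, ?_⟩
      simp only
      rw [le_val_iff]
      have e : (h 0 0 * g 0 0 + h 0 1 * g 1 0) / c - h 0 0 / h 1 0 =
          -(g 1 0 * h.det) / (c * h 1 0) := by
        rw [div_sub_div _ _ hc0 hγ', hD', hc]; congr 1; ring
      rw [e]
      intro hne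
      have hg0 : g 1 0 ≠ 0 := by
        intro h0; rw [h0] at hne; simp at hne
      rw [ordR_div (neg_ne_zero.2 (mul_ne_zero hg0 hh)) (mul_ne_zero hc0 hγ'), ordR_neg,
        ordR_mul hg0 hh, ordR_mul hc0 hγ']
      linarith [hA hg0]
  · rw [moebius_of_le g hγ hA]
    rw [← hw] at hA
    have hp : h 1 0 * (g 0 0 / g 1 0) + h 1 1 = c / g 1 0 := by
      rw [hc]; field_simp
    have hcd : c * w - g 1 0 * u = h 1 0 * g.det := by
      rw [hc, hu, hD, hw]; ring
    rcases moebius_cases (v := v) h hh (g 0 0 / g 1 0)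
      (ordR v g.det - 2 * ordR v (g 1 0) - r) with ⟨hp0, hB⟩ | ⟨hγ', hB⟩
    · rw [moebius_of_lt h hp0 hB]
      rw [hp] at hp0 hB ⊢
      have hc0 : c ≠ 0 := fun h0 => hp0 (by rw [h0, zero_div])
      have oc := ordR_div (v := v) hc0 hγ
      have hc2 : u ≠ 0 → ordR v c + r ≤ ordR v u := by
        intro hu0
        have h1 : c * w + -(h 1 0 * g.det) = g 1 0 * u := by rw [← hcd]; ring
        have h2 := le_ordR_add (v := v) (x := c * w) (y := -(h 1 0 * g.det))
          (r := ordR v c + ordR v (g 1 0) + r) (by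
            intro hne
            have hw0 := right_ne_zero_of_mul hne
            rw [ordR_mul hc0 hw0]
            linarith [hA hw0]) (by
            intro hne
            have hh0 := left_ne_zero_of_mul (neg_ne_zero.1 hne)
            rw [ordR_neg, ordR_mul hh0 hg]
            linarith [hB hh0]) (by rw [h1]; exact mul_ne_zero hγ hu0)
        rw [h1, ordR_mul hγ hu0] at h2
        linarith
      rw [snd hc0 hc2, oc]
      refine ⟨by simp only; ring, ?_⟩
      have : (h 0 0 * g 0 0 + h 0 1 * g 1 0) / c -
          (h 0 0 * (g 0 0 / g 1 0) + h 0 1) / (c / g 1 0) = 0 := by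
        field_simp
        ring
      simp only [this, AddValuation.map_zero, le_top]
    · rw [moebius_of_le h hγ' hB]
      rw [hp] at hB
      have hX : h 1 0 * g.det ≠ 0 := mul_ne_zero hγ' hg
      have oX := ordR_mul (v := v) hγ' hg
      rcases hcase with ⟨hu0, hc1⟩ | ⟨hc0, hc2⟩
      · rw [fst hu0 hc1]
        have hgu := mul_ne_zero hγ hu0
        have ogu := ordR_mul (v := v) hγ hu0
        have hdom := ordR_add_eq (v := v) (x := -(g 1 0 * u)) (y := c * w)
          (neg_ne_zero.2 hgu) (by
            intro hne
            have hc0 := left_ne_zero_of_mul hne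
            have hw0 := right_ne_zero_of_mul hne
            rw [ordR_neg, ogu, ordR_mul hc0 hw0]
            linarith [hc1 hc0, hA hw0])
        rw [neg_add_eq_sub, hcd, ordR_neg, ogu, oX] at hdom
        have ho := hdom.2
        refine ⟨by simp only; linarith, ?_⟩
        simp only
        rw [le_val_iff]
        have e : (h 0 0 * (g 0 0 * a + g 0 1) + h 0 1 * w) / u - h 0 0 / h 1 0 =
            -(w * h.det) / (u * h 1 0) := by
          rw [div_sub_div _ _ hu0 hγ', hD']; congr 1; rw [hu]; ring
        rw [e]
        intro hne
        have hw0 : w ≠ 0 := by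
          intro h0; rw [h0] at hne; simp at hne
        rw [ordR_div (neg_ne_zero.2 (mul_ne_zero hw0 hh)) (mul_ne_zero hu0 hγ'), ordR_neg,
          ordR_mul hw0 hh, ordR_mul hu0 hγ']
        linarith [hA hw0]
      · rw [snd hc0 hc2]
        have h1 := hB (div_ne_zero hc0 hγ)
        rw [ordR_div hc0 hγ] at h1
        have h2 := le_ordR_add (v := v) (x := c * w) (y := -(g 1 0 * u))
          (r := ordR v c + ordR v (g 1 0) + r) (by
            intro hne
            have hw0 := right_ne_zero_of_mul hne
            rw [ordR_mul hc0 hw0]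
            linarith [hA hw0]) (by
            intro hne
            have hu0 := right_ne_zero_of_mul (neg_ne_zero.1 hne)
            rw [ordR_neg, ordR_mul hγ hu0]
            linarith [hc2 hu0]) (by rw [← sub_eq_add_neg, hcd]; exact hX)
        rw [← sub_eq_add_neg, hcd, oX] at h2
        refine ⟨by simp only; linarith, ?_⟩
        simp only
        rw [le_val_iff]
        have e : (h 0 0 * g 0 0 + h 0 1 * g 1 0) / c - h 0 0 / h 1 0 =
            -(g 1 0 * h.det) / (c * h 1 0) := by
          rw [div_sub_div _ _ hc0 hγ', hD', hc]; congr 1; ring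
        rw [e]
        intro _
        rw [ordR_div (neg_ne_zero.2 (mul_ne_zero hγ hh)) (mul_ne_zero hc0 hγ'), ordR_neg,
          ordR_mul hγ hh, ordR_mul hc0 hγ']
        linarith

/-- The action of `GL₂(F)` on the points of type II and III by Möbius transformations. -/
instance : MulAction (GL (Fin 2) F) (BerkH v) where
  smul g x := Quotient.map (sa := ballSetoid v) (sb := ballSetoid v) (moebius v g.1)
    (fun p q h => moebius_congr g.1 g.det.ne_zero p q h) x
  one_smul x := by
    obtain ⟨a, r, rfl⟩ := exists_eta x
    have h1 : ordR v (1 : F) = 0 := ordR_of_val (AddValuation.map_one v)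
    have h : moebius v (1 : Matrix (Fin 2) (Fin 2) F) (a, r) = (a, r) := by
      rw [moebius_of_lt] <;> simp [h1]
    exact congrArg (Quotient.mk (ballSetoid v)) h
  mul_smul h g x := by
    obtain ⟨a, r, rfl⟩ := exists_eta x
    exact Quotient.sound (moebius_mul h.1 g.1 h.det.ne_zero g.det.ne_zero (a, r))

variable {v} in
theorem smul_eta (g : GL (Fin 2) F) (a : F) (r : ℝ) :
    g • eta v a r = eta v (moebius v g.1 (a, r)).1 (moebius v g.1 (a, r)).2 := rfl

open Classical in
variable {v} in
/-- The action of the matrix `!![0, 1; 1, 0]`. -/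
theorem inversion_smul_eta (g : GL (Fin 2) F) (hg : g.1 = !![0, 1; 1, 0]) (a : F) (r : ℝ) :
    g • eta v a r =
      if v a < (r : WithTop ℝ) then eta v (1 / a) (r - 2 * ordR v a) else eta v 0 (-r) := by
  have h1 : ordR v (1 : F) = 0 := ordR_of_val (AddValuation.map_one v)
  rw [smul_eta, hg]
  split_ifs with h <;> simp [moebius, h, h1, ordR_neg]

variable {v} in
/-- The action of the upper triangular matrix `!![d₁, f; 0, d₂]`. -/
theorem upper_smul_eta (g : GL (Fin 2) F) (d₁ d₂ f : F) (h₁ : d₁ ≠ 0) (h₂ : d₂ ≠ 0)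
    (hg : g.1 = !![d₁, f; 0, d₂]) (a : F) (r : ℝ) :
    g • eta v a r = eta v ((d₁ * a + f) / d₂) (r + ordR v (d₁ / d₂)) := by
  rw [smul_eta, hg, moebius_of_lt _ (by simpa using h₂) (by simp)]
  rw [ordR_div h₁ h₂]
  congr 1
  · simp
  · simp [ordR_mul h₁ h₂]
    ring

end BerkH
end Points

/-! ### The action of `SL₂(Ā)` and the modular ray -/

section Modular

variable (E : Type*) [Field E]

/-- The set `ℍ_ℝ^Berk` of points of type II and III of the Berkovich projective line over `K̂`. -/
abbrev HBerk : Type _ := BerkH (nu E)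

/-- The homomorphism `SL₂(Ā) → GL₂(K̂)` given by the inclusion `Ā → K̂`. -/
def slToGL : SpecialLinearGroup (Fin 2) (puiseuxPoly E) →* GL (Fin 2) (KHat E) :=
  SpecialLinearGroup.toGL.comp (SpecialLinearGroup.map (polyToKHat E))

/-- The action of `SL₂(Ā)`, through `GL₂(K̂)`. -/
instance : MulAction (SpecialLinearGroup (Fin 2) (puiseuxPoly E)) (HBerk E) :=
  MulAction.compHom _ (slToGL E)

/-- The modular ray `{η_{0,r} | r ≤ 0}`. -/
def modularRay : Set (HBerk E) := {x | ∃ r : ℝ, r ≤ 0 ∧ x = BerkH.eta (nu E) 0 r}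

/-- `D` is a fundamental domain (in the sense of trees) for the action of `G` on `X`: each orbit
meets `D` in exactly one point. -/
def IsFundDomain (G : Type*) {X : Type*} [Group G] [MulAction G X] (D : Set X) : Prop :=
  ∀ x : X, ∃! y : X, y ∈ D ∧ y ∈ MulAction.orbit G x

end Modular

end PuiseuxBerk

end

namespace PuiseuxBerk

open Matrix

/-! ### Puiseux polynomials as integer parts in `K̂` -/

section Approximation

variable {E : Type*} [Field E]

/-! The ring Ā plays the part of E[t] in E((1/t)), and two opposite facts carry everything. A
nonzero Puiseux polynomial has ν ≤ 0 (`ordR_polyToKHat_le`), while every element of K̂ lies within ν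
≥ 0 of a Puiseux polynomial (`exists_puiseuxPoly_nu_sub_nonneg`).

Part (a): for r < 0 the first fact forces the stabilizer of η_{0,r} to be upper triangular with
diagonal entries of valuation 0, so it acts by affine maps preserving ν and the radius parameter.
The second fact supplies translations joining any two points of 𝒱^s, because at radius parameter r +
s ≤ 0 an error of valuation ≥ 0 is invisible.

Part (b), existence: a continued fraction algorithm. By density the centre may be taken in some K_n;
its polynomial part is removed by a translation, then z ↦ -1/z is applied. This never leaves K_n,
whose value group is (1/n)ℤ, so each inversion lowers the radius parameter by at least 2/n and the
process stops (`exists_smul_eta_coe_eq`).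

Uniqueness: by the first fact the radius parameter of η_{0,r}, r ≤ 0, is minimal among the points of
its orbit (`le_of_smul_eta_zero`), so it is an invariant of the orbit. -/

theorem ordR_nu_coe {x : PuiseuxField E} (hx : x ≠ 0) :
    ∃ q ∈ (x.toHahn E).support, ordR (nu E) (x : KHat E) = (q : ℝ) := by
  have h0 : x.toHahn E ≠ 0 := (map_ne_zero _).2 hx
  refine ⟨(x.toHahn E).order, ?_, ordR_of_val ?_⟩
  · exact fun h => h0 (HahnSeries.coeff_order_eq_zero.1 h)
  · have h : puiseuxVal E x = (x.toHahn E).orderTop := HahnSeries.addVal_apply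
    rw [nu_coe, h, ← HahnSeries.order_eq_orderTop_of_ne_zero h0]
    rfl

theorem polyToKHat_ne_zero {f : puiseuxPoly E} (hf : f ≠ 0) : polyToKHat E f ≠ 0 := by
  intro h
  refine hf (Subtype.ext ?_)
  exact UniformSpace.Completion.coe_injective (PuiseuxField E) h

/-- Nonzero Puiseux polynomials have nonpositive valuation. -/
theorem ordR_polyToKHat_le {f : puiseuxPoly E} (hf : f ≠ 0) :
    ordR (nu E) (polyToKHat E f) ≤ 0 := by
  obtain ⟨q, hq, h⟩ := ordR_nu_coe (x := (f : PuiseuxField E)) (fun h => hf (Subtype.ext h))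
  change ordR (nu E) ((f : PuiseuxField E) : KHat E) ≤ 0
  rw [h]
  exact_mod_cast f.2.2 q hq

/-- The Puiseux field is dense in `K̂` for the valuation `ν`. -/
theorem exists_coe_nu_sub_ge (a : KHat E) (r : ℝ) :
    ∃ x : PuiseuxField E, (r : WithTop ℝ) ≤ nu E (a - x) := by
  obtain ⟨q, hq⟩ := exists_rat_gt r
  have hfin : (HahnSeries.single q (1 : E)).support.Finite :=
    (Set.finite_singleton q).subset HahnSeries.support_single_subset
  let y : PuiseuxField E := ⟨HahnSeries.single q (1 : E), mem_puiseuxSubfield_of_finite E _ hfin⟩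
  have hy : nu E (y : KHat E) = ((q : ℝ) : WithTop ℝ) := by
    have h : puiseuxVal E y = (HahnSeries.single q (1 : E)).orderTop := HahnSeries.addVal_apply
    rw [nu_coe, h, HahnSeries.orderTop_single one_ne_zero]
    rfl
  have hy0 : (y : KHat E) ≠ 0 := by
    intro h
    rw [h, AddValuation.map_zero] at hy
    exact WithTop.top_ne_coe hy
  -- The monomial y of valuation q > r serves as a radius. The order of `Valued.v` is opposite to
  -- that of ν, so this neighbourhood is the set where ν(z - a) > q.
  have hmem : {z : KHat E | (Valued.v (R := KHat E)) (z - a) < Valued.v (y : KHat E)} ∈ nhds a := by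
    rw [Valued.mem_nhds]
    refine ⟨Units.mk0 ((Valued.v (R := KHat E)).restrict (y : KHat E)) ?_, ?_⟩
    · simpa using hy0
    · intro z hz
      simpa using hz
  obtain ⟨_, hz, x, rfl⟩ := mem_closure_iff_nhds.1
    (UniformSpace.Completion.denseRange_coe (α := PuiseuxField E) a) _ hmem
  refine ⟨x, ?_⟩
  have hle : nu E (y : KHat E) ≤ nu E ((x : KHat E) - a) := by
    change WithTop.map _ _ ≤ WithTop.map _ _
    exact (WithTop.monotone_map_iff.2 (fun p q hpq => by simpa using hpq)) (le_of_lt hz)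
  rw [AddValuation.map_sub_swap]
  exact le_trans (by rw [hy]; exact WithTop.coe_le_coe.2 hq.le) hle

/-- An element of `K_n` differs by a Puiseux polynomial from one of valuation at least `1 / n`. -/
theorem exists_mem_puiseuxPoly_sub {n : ℕ+} {x : PuiseuxField E} (hx : x.toHahn E ∈ kField E n) :
    ∃ f : puiseuxPoly E, (x - f).toHahn E ∈ kField E n ∧
      ∀ q ∈ ((x - f).toHahn E).support, (1 : ℚ) / n ≤ q := by
  have hn : (0 : ℚ) < (n : ℕ) := by exact_mod_cast n.pos
  have hx' := (mem_kField_iff E n _).1 hx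
  -- Exponents of x lie in (1/n)ℤ, so those below 1/n are exactly the nonpositive ones: this
  -- truncation is the polynomial part, and what is left starts at 1/n or later.
  set h := HahnSeries.truncLT ((1 : ℚ) / n) (x.toHahn E) with hh
  have hsub : h.support ⊆ (x.toHahn E).support := HahnSeries.support_truncLT_subset _ _
  have hneg : ∀ q ∈ h.support, ∃ k : ℤ, (k : ℚ) / n = q ∧ k ≤ 0 := by
    intro q hq
    obtain ⟨k, rfl⟩ := hx' q (hsub hq)
    rw [hh, HahnSeries.support_truncLT] at hq
    have h1 : (k : ℚ) / n < 1 / n := hq.2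
    rw [div_lt_div_iff_of_pos_right hn] at h1
    have h2 : k < 1 := by exact_mod_cast h1
    exact ⟨k, rfl, by omega⟩
  have hfin : h.support.Finite := by
    -- The exponents k/n of the truncation have k ≤ 0 and are bounded below by the order of x, which
    -- leaves finitely many k.
    refine ((Set.finite_Icc ⌊(x.toHahn E).order * n⌋ 0).image (fun k : ℤ => (k : ℚ) / n)).subset ?_
    intro q hq
    obtain ⟨k, rfl, hk⟩ := hneg q hq
    refine ⟨k, ⟨?_, hk⟩, rfl⟩
    have h1 : (x.toHahn E).order ≤ (k : ℚ) / n := HahnSeries.order_le_of_coeff_ne_zero (hsub hq)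
    rw [le_div_iff₀ hn] at h1
    exact_mod_cast (Int.floor_le _).trans h1
  let y : PuiseuxField E := ⟨h, mem_puiseuxSubfield_of_finite E _ hfin⟩
  have hy : y.toHahn E = h := rfl
  have hhk : h ∈ kField E n := (mem_kField_iff E n _).2 fun q hq => hx' q (hsub hq)
  refine ⟨⟨y, hfin, ?_⟩, ?_, ?_⟩
  · intro q hq
    obtain ⟨k, rfl, hk⟩ := hneg q hq
    exact div_nonpos_of_nonpos_of_nonneg (by exact_mod_cast hk) hn.le
  · rw [map_sub]
    exact sub_mem hx hhk
  · intro q hq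
    by_contra! hlt
    refine hq ?_
    change ((x - y).toHahn E).coeff q = 0
    rw [map_sub, hy, HahnSeries.coeff_sub, hh, HahnSeries.coeff_truncLT_of_lt hlt, sub_self]

/-- Density gives an approximation in some K_n, whose polynomial part is then f. The gap 1/n is
discarded, since n depends on a; the bound 0 suffices at radius parameters ≤ 0. -/
theorem exists_puiseuxPoly_nu_sub_nonneg (a : KHat E) :
    ∃ f : puiseuxPoly E, ((0 : ℝ) : WithTop ℝ) ≤ nu E (a - polyToKHat E f) := by
  obtain ⟨x, hx⟩ := exists_coe_nu_sub_ge a 0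
  obtain ⟨n, hn⟩ := (mem_puiseuxSubfield E _).1 x.2
  obtain ⟨f, -, hf⟩ := exists_mem_puiseuxPoly_sub (x := x) hn
  refine ⟨f, ?_⟩
  have h : ((0 : ℝ) : WithTop ℝ) ≤ nu E ((x - (f : PuiseuxField E) : PuiseuxField E) : KHat E) := by
    rw [le_val_iff]
    intro h0
    obtain ⟨q, hq, h⟩ := ordR_nu_coe (x := x - (f : PuiseuxField E))
      (by rintro h; rw [h] at h0; exact h0 rfl)
    rw [h]
    have : (0 : ℚ) ≤ q := le_trans (by positivity) (hf q hq)
    exact_mod_cast this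
  have := AddValuation.map_le_add (nu E) hx h
  rwa [UniformSpace.Completion.coe_sub, sub_add_sub_cancel] at this

end Approximation

/-! ### Translations, the inversion, and radius parameters -/

section Action

variable {E : Type*} [Field E]

open BerkH

theorem sl_smul_eta (g : SpecialLinearGroup (Fin 2) (puiseuxPoly E)) (a : KHat E) (r : ℝ) :
    g • eta (nu E) a r = eta (nu E) (moebius (nu E) (slToGL E g).1 (a, r)).1
      (moebius (nu E) (slToGL E g).1 (a, r)).2 := rfl

theorem slToGL_apply (g : SpecialLinearGroup (Fin 2) (puiseuxPoly E)) (i j : Fin 2) :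
    (slToGL E g).1 i j = polyToKHat E (g.1 i j) := rfl

theorem slToGL_det (g : SpecialLinearGroup (Fin 2) (puiseuxPoly E)) :
    (slToGL E g).1.det = 1 :=
  (SpecialLinearGroup.map (polyToKHat E) g).2

theorem ordR_one : ordR (nu E) (1 : KHat E) = 0 := ordR_of_val (AddValuation.map_one _)

theorem exists_translation (f : puiseuxPoly E) :
    ∃ g : SpecialLinearGroup (Fin 2) (puiseuxPoly E), ∀ (a : KHat E) (r : ℝ),
      g • eta (nu E) a r = eta (nu E) (a + polyToKHat E f) r := by
  obtain ⟨g, hg⟩ : ∃ g : SpecialLinearGroup (Fin 2) (puiseuxPoly E), g.1 = !![1, f; 0, 1] :=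
    ⟨⟨!![1, f; 0, 1], by simp [det_fin_two]⟩, rfl⟩
  refine ⟨g, fun a r => ?_⟩
  refine (upper_smul_eta (slToGL E g) 1 1 (polyToKHat E f) one_ne_zero one_ne_zero ?_ a r).trans ?_
  · ext i j
    rw [slToGL_apply, hg]
    fin_cases i <;> fin_cases j <;> simp
  · simp [ordR_one]

/-- The map is z ↦ -1/z, with pole 0. A ball centred at 0 contains the pole, which gives the second
branch of `moebius`; the condition ν(a) < r says that the pole lies outside the ball, which gives
the first. -/
theorem exists_inversion : ∃ g : SpecialLinearGroup (Fin 2) (puiseuxPoly E),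
    (∀ r : ℝ, g • eta (nu E) 0 r = eta (nu E) 0 (-r)) ∧
    ∀ (a : KHat E) (r : ℝ), a ≠ 0 → ordR (nu E) a < r →
      g • eta (nu E) a r = eta (nu E) (-a⁻¹) (r - 2 * ordR (nu E) a) := by
  obtain ⟨g, hg⟩ : ∃ g : SpecialLinearGroup (Fin 2) (puiseuxPoly E), g.1 = !![0, -1; 1, 0] :=
    ⟨⟨!![0, -1; 1, 0], by simp [det_fin_two]⟩, rfl⟩
  refine ⟨g, fun r => ?_, fun a r ha h => ?_⟩
  · rw [sl_smul_eta, moebius_of_le]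
    all_goals simp [slToGL_apply, hg, ordR_one, slToGL_det]
  · rw [sl_smul_eta, moebius_of_lt]
    all_goals simp [slToGL_apply, hg, ordR_one, slToGL_det, ha, h, neg_div]

/-- Elements of `SL₂(Ā)` cannot decrease the radius parameter of `η_{0,r}`, for `r ≤ 0`. -/
theorem le_of_smul_eta_zero {g : SpecialLinearGroup (Fin 2) (puiseuxPoly E)} {r r' : ℝ}
    {b : KHat E} (hr : r ≤ 0) (h : g • eta (nu E) 0 r = eta (nu E) b r') : r ≤ r' := by
  have key : ∀ i j, (slToGL E g).1 i j ≠ 0 → ordR (nu E) ((slToGL E g).1 i j) ≤ 0 := by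
    intro i j h0
    rw [slToGL_apply] at h0 ⊢
    exact ordR_polyToKHat_le fun h1 => h0 (by rw [h1, map_zero])
  rw [sl_smul_eta, eta_eq_iff] at h
  rw [← h.1]
  -- As det g = 1, the new radius parameter is r - 2ν(δ) or -2ν(γ) - r. Entries of Ā have ν ≤ 0, so
  -- the first is at least r and the second at least -r ≥ r.
  rcases moebius_cases (v := nu E) (slToGL E g).1 (by simp [slToGL_det]) 0 r with ⟨h1, h2⟩ | ⟨h1, h2⟩
  · rw [moebius_of_lt _ h1 h2, slToGL_det, ordR_one]
    simp only [mul_zero, zero_add] at h1 ⊢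
    linarith [key 1 1 h1]
  · rw [moebius_of_le _ h1 h2, slToGL_det, ordR_one]
    simp only
    linarith [key 1 0 h1]

/-! ### Stabilizers of points of the ray, and transitivity below them -/

/-- Suppose γ ≠ 0, so ν(γ) ≤ 0. With the pole outside the ball, an unchanged radius parameter means
ν(δ) = 0, against ν(δ) < ν(γ) + r < 0. Otherwise the new parameter is -2ν(γ) - r ≥ -r > r. At r = 0
this fails: z ↦ -1/z fixes η_{0,0}. -/
theorem upper_of_smul_eta_zero {g : SpecialLinearGroup (Fin 2) (puiseuxPoly E)} {r : ℝ}
    (hr : r < 0) (h : g • eta (nu E) 0 r = eta (nu E) 0 r) : g.1 1 0 = 0 := by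
  have key : ∀ i j, (slToGL E g).1 i j ≠ 0 → ordR (nu E) ((slToGL E g).1 i j) ≤ 0 := by
    intro i j h0
    rw [slToGL_apply] at h0 ⊢
    exact ordR_polyToKHat_le fun h1 => h0 (by rw [h1, map_zero])
  by_contra hc
  have hc' : (slToGL E g).1 1 0 ≠ 0 := polyToKHat_ne_zero hc
  rw [sl_smul_eta, eta_eq_iff] at h
  have h0 := h.1
  rcases moebius_cases (v := nu E) (slToGL E g).1 (by simp [slToGL_det]) 0 r with ⟨h1, h2⟩ | ⟨h1, h2⟩
  · rw [moebius_of_lt _ h1 h2, slToGL_det, ordR_one] at h0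
    simp only at h0
    linarith [key 1 0 hc', h2 hc']
  · rw [moebius_of_le _ h1 h2, slToGL_det, ordR_one] at h0
    simp only at h0
    linarith [key 1 0 h1]

/-- Elements of the stabilizer of `η_{0,r}`, for `r < 0`, act by affine maps that
preserve the valuation. -/
theorem exists_affine_of_smul_eta_zero {g : SpecialLinearGroup (Fin 2) (puiseuxPoly E)} {r : ℝ}
    (hr : r < 0) (h : g • eta (nu E) 0 r = eta (nu E) 0 r) :
    ∃ u c : KHat E, nu E u = 0 ∧ (r : WithTop ℝ) ≤ nu E c ∧
      ∀ (a : KHat E) (s : ℝ), g • eta (nu E) a s = eta (nu E) (u * a + c) s := by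
  have hc := upper_of_smul_eta_zero hr h
  have hdet := g.2
  rw [det_fin_two, hc, mul_zero, sub_zero] at hdet
  have h1 : g.1 0 0 ≠ 0 := left_ne_zero_of_mul_eq_one hdet
  have h2 : g.1 1 1 ≠ 0 := right_ne_zero_of_mul_eq_one hdet
  set d₁ := polyToKHat E (g.1 0 0) with hd₁
  set d₂ := polyToKHat E (g.1 1 1) with hd₂
  have h1' : d₁ ≠ 0 := polyToKHat_ne_zero h1
  have h2' : d₂ ≠ 0 := polyToKHat_ne_zero h2
  have h3 : ordR (nu E) d₁ + ordR (nu E) d₂ = 0 := by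
    rw [← ordR_mul h1' h2', hd₁, hd₂, ← map_mul, hdet, map_one, ordR_one]
  have h4 : ordR (nu E) d₁ ≤ 0 := ordR_polyToKHat_le h1
  have h5 : ordR (nu E) d₂ ≤ 0 := ordR_polyToKHat_le h2
  -- Two numbers ≤ 0 with sum 0 both vanish.
  have hu : ordR (nu E) (d₁ / d₂) = 0 := by
    rw [ordR_div h1' h2']
    linarith
  have hact : ∀ (a : KHat E) (s : ℝ), g • eta (nu E) a s =
      eta (nu E) (d₁ / d₂ * a + polyToKHat E (g.1 0 1) / d₂) s := by
    intro a s
    refine (upper_smul_eta (slToGL E g) d₁ d₂ (polyToKHat E (g.1 0 1)) h1' h2' ?_ a s).trans ?_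
    · ext i j
      rw [slToGL_apply]
      fin_cases i <;> fin_cases j <;> simp [hd₁, hd₂, hc]
    · rw [hu, add_zero]
      congr 1
      field_simp
  refine ⟨d₁ / d₂, _, ?_, ?_, hact⟩
  · rw [val_eq (div_ne_zero h1' h2'), hu]
    rfl
  -- The affine map sends η_{0,r} to η_{c,r}, and these two points agree exactly when ν(c) ≥ r.
  · rw [hact, eta_eq_iff] at h
    simpa using h.2

theorem mem_below_eta_zero {r s : ℝ} (hs : 0 < s) {y : HBerk E} :
    y ∈ below (nu E) s (eta (nu E) 0 r) ↔
      ∃ a : KHat E, (r : WithTop ℝ) ≤ nu E a ∧ y = eta (nu E) a (r + s) := by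
  obtain ⟨a, r', rfl⟩ := exists_eta y
  have hm : nu E (0 - a) = nu E a := by rw [zero_sub, AddValuation.map_neg]
  constructor
  · rintro ⟨h1, h2⟩
    rw [above_eta, hm] at h1
    rw [distance_eta, hm, min_eq_left h1.1, if_pos h1.2, abs_sub_comm,
      abs_of_nonneg (sub_nonneg.2 h1.1)] at h2
    exact ⟨a, h1.2, by rw [← h2, add_sub_cancel]⟩
  · rintro ⟨b, hb, h⟩
    rw [h]
    have hm : nu E (0 - b) = nu E b := by rw [zero_sub, AddValuation.map_neg]
    refine ⟨above_eta.2 ⟨by linarith, by rwa [hm]⟩, ?_⟩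
    rw [distance_eta, hm, min_eq_left (by linarith), if_pos hb]
    rw [sub_add_cancel_left, abs_neg, abs_of_pos hs]

/-- One inclusion is invariance of the set, the other transitivity on it. The bounds on s force r <
0, so the stabilizer is affine; transitivity already holds for the translations in it. -/
theorem orbit_stabilizer_eq_below {r s : ℝ} (hs : 0 < s) (hsr : s ≤ -r) {x : HBerk E}
    (hx : x ∈ below (nu E) s (eta (nu E) 0 r)) :
    MulAction.orbit (MulAction.stabilizer (SpecialLinearGroup (Fin 2) (puiseuxPoly E))
      (eta (nu E) 0 r)) x = below (nu E) s (eta (nu E) 0 r) := by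
  obtain ⟨a, ha, rfl⟩ := (mem_below_eta_zero hs).1 hx
  ext y
  constructor
  · rintro ⟨⟨g, hg⟩, rfl⟩
    obtain ⟨u, c, hu, hc, h⟩ := exists_affine_of_smul_eta_zero (by linarith) hg
    refine (mem_below_eta_zero hs).2 ⟨u * a + c, ?_, h a _⟩
    refine AddValuation.map_le_add _ ?_ hc
    rwa [AddValuation.map_mul, hu, zero_add]
  · intro hy
    obtain ⟨b, hb, rfl⟩ := (mem_below_eta_zero hs).1 hy
    obtain ⟨f, hf⟩ := exists_puiseuxPoly_nu_sub_nonneg (b - a)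
    obtain ⟨g, hg⟩ := exists_translation f
    -- f = b - a - (b - a - f), and each of the three terms has valuation at least r; hence
    -- translation by f fixes η_{0,r}.
    have hf' : (r : WithTop ℝ) ≤ nu E (polyToKHat E f) := by
      have h1 : (r : WithTop ℝ) ≤ nu E (b - a - polyToKHat E f) :=
        le_trans (WithTop.coe_le_coe.2 (by linarith)) hf
      have h2 := AddValuation.map_le_sub _ (AddValuation.map_le_sub _ hb ha) h1
      rwa [sub_sub_cancel] at h2
    refine ⟨⟨g, ?_⟩, ?_⟩
    · rw [MulAction.mem_stabilizer_iff, hg, eta_eq_iff]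
      simpa using hf'
    -- The centres a + f and b differ by an element of valuation ≥ 0 ≥ r + s, so they define the
    -- same point.
    · refine (hg a (r + s)).trans (eta_eq_iff.2 ⟨rfl, ?_⟩)
      rw [AddValuation.map_sub_swap, ← sub_sub]
      exact le_trans (WithTop.coe_le_coe.2 (by linarith)) hf

/-! ### The modular ray as a fundamental domain -/

/-- Reduction to the modular ray: translations and inversions decrease the radius parameter of a
point centred in `K_n` by at least `2 / n` as long as it is not on the ray. -/
theorem exists_smul_eta_coe_eq {n : ℕ+} (N : ℕ) : ∀ (x : PuiseuxField E) (r : ℝ),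
    x.toHahn E ∈ kField E n → r * n ≤ N →
    ∃ r' ≤ 0, ∃ g : SpecialLinearGroup (Fin 2) (puiseuxPoly E),
      g • eta (nu E) (x : KHat E) r = eta (nu E) 0 r' := by
  have hn : (0 : ℝ) < (n : ℕ) := by exact_mod_cast n.pos
  induction N with
  | zero =>
    intro x r hx hr
    have hr0 : r ≤ 0 := by
      by_contra! h
      have := mul_pos h hn
      simp at hr
      linarith
    obtain ⟨f, hf⟩ := exists_puiseuxPoly_nu_sub_nonneg (x : KHat E)
    obtain ⟨g, hg⟩ := exists_translation (-f)
    refine ⟨r, hr0, g, ?_⟩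
    rw [hg, eta_eq_iff, map_neg, ← sub_eq_add_neg, sub_zero]
    exact ⟨rfl, le_trans (WithTop.coe_le_coe.2 hr0) hf⟩
  | succ N ih =>
    intro x r hx hr
    obtain ⟨f, hk, hf⟩ := exists_mem_puiseuxPoly_sub hx
    obtain ⟨g, hg⟩ := exists_translation (-f)
    obtain ⟨S, hS0, hS⟩ := exists_inversion (E := E)
    set y : PuiseuxField E := x - f with hy
    have hgx : g • eta (nu E) (x : KHat E) r = eta (nu E) (y : KHat E) r := by
      rw [hg, map_neg, ← sub_eq_add_neg, hy, UniformSpace.Completion.coe_sub]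
      rfl
    -- If the translated ball contains 0, the point is η_{0,r}, on the ray up to one inversion. If
    -- not, the pole 0 of the inversion is outside the ball and the descent continues.
    by_cases hyr : (r : WithTop ℝ) ≤ nu E (y : KHat E)
    · have h0 : eta (nu E) (y : KHat E) r = eta (nu E) 0 r := eta_eq_iff.2 ⟨rfl, by rwa [sub_zero]⟩
      rcases le_total r 0 with hr0 | hr0
      · exact ⟨r, hr0, g, hgx.trans h0⟩
      · exact ⟨-r, by linarith, S * g, by rw [mul_smul, hgx, h0, hS0]⟩
    · have hy0' : (y : KHat E) ≠ 0 := ne_zero_of_val_lt (not_le.1 hyr)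
      have hy0 : y ≠ 0 := by
        intro h
        rw [h] at hy0'
        exact hy0' rfl
      rw [val_eq hy0', WithTop.coe_le_coe, not_le] at hyr
      obtain ⟨q, hq, hord⟩ := ordR_nu_coe hy0
      have h1 : (1 : ℝ) / n ≤ ordR (nu E) (y : KHat E) := by
        rw [hord]
        have := hf q hq
        simpa using (Rat.cast_le (K := ℝ)).2 this
      rw [div_le_iff₀ hn] at h1
      -- K_n is a field, so the new centre -1/y stays in it and n is unchanged. As ν(y) ≥ 1/n, the
      -- quantity r n drops by at least 2, more than the 1 that the induction needs.
      obtain ⟨r', hr', g', hg'⟩ := ih (-y⁻¹) (r - 2 * ordR (nu E) (y : KHat E))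
        (by rw [map_neg, map_inv₀]; exact neg_mem (inv_mem hk))
        (by push_cast at hr; nlinarith)
      refine ⟨r', hr', g' * (S * g), ?_⟩
      rw [mul_smul, mul_smul, hgx, hS _ _ hy0' hyr, ← hg', UniformSpace.Completion.coe_neg,
        UniformSpace.Completion.coe_inv]

theorem isFundDomain_modularRay :
    IsFundDomain (SpecialLinearGroup (Fin 2) (puiseuxPoly E)) (modularRay E) := by
  intro z
  obtain ⟨a, r, rfl⟩ := exists_eta z
  obtain ⟨x, hx⟩ := exists_coe_nu_sub_ge a r
  -- The centre matters only up to valuation r, so it may be chosen in the Puiseux field, hence in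
  -- some K_n.
  rw [(eta_eq_iff.2 ⟨rfl, hx⟩ : eta (nu E) a r = eta (nu E) (x : KHat E) r)]
  obtain ⟨n, hn⟩ := (mem_puiseuxSubfield E _).1 x.2
  obtain ⟨N, hN⟩ := exists_nat_ge (r * n)
  obtain ⟨r', hr', g, hg⟩ := exists_smul_eta_coe_eq N x r hn hN
  refine ⟨eta (nu E) 0 r', ⟨⟨r', hr', rfl⟩, g, hg⟩, ?_⟩
  rintro _ ⟨⟨s, hs, rfl⟩, g', hg'⟩
  -- If g z = η_{0,r} and g' z = η_{0,s}, then g' g⁻¹ carries the first to the second. Applied in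
  -- both directions, this yields equality of the parameters.
  have hle : ∀ {r s : ℝ} {g g' : SpecialLinearGroup (Fin 2) (puiseuxPoly E)} {z : HBerk E},
      r ≤ 0 → g • z = eta (nu E) 0 r → g' • z = eta (nu E) 0 s → r ≤ s := by
    intro r s g g' z hr h h'
    refine le_of_smul_eta_zero (g := g' * g⁻¹) (b := 0) hr ?_
    rw [← h, mul_smul, inv_smul_smul, h']
  rw [le_antisymm (hle hs hg' hg) (hle hr' hg hg')]

end Action

end PuiseuxBerk

open PuiseuxBerk Matrix in
theorem mainTheorem5 (E : Type*) [Field E] :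
    (∀ r s : ℝ, r ≤ 0 → 0 < s → s ≤ -r →
      ∀ x ∈ BerkH.below (nu E) s (BerkH.eta (nu E) 0 r),
        MulAction.orbit
          (MulAction.stabilizer (SpecialLinearGroup (Fin 2) (puiseuxPoly E))
            (BerkH.eta (nu E) 0 r)) x =
          BerkH.below (nu E) s (BerkH.eta (nu E) 0 r)) ∧
    IsFundDomain (SpecialLinearGroup (Fin 2) (puiseuxPoly E)) (modularRay E) :=
  ⟨fun _ _ _ hs hsr _ hx => orbit_stabilizer_eq_below hs hsr hx, isFundDomain_modularRay⟩
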